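/- Let $K\ge 2$, $n\ge 1$ and $d$ be natural numbers. For $W=[w_1,\dots,w_K]^\top\in\mathbb{R}^{K\times d}$ and $H=[h_{k,i}]_{1\le k\le K,\,1\le i\le n}\in\mathbb{R}^{d\times Kn}$ (with columns $h_{k,i}\in\mathbb{R}^d$), let $$\mathcal{L}(W,H)=-\sum_{k=1}^{K}\sum_{i=1}^{n}\log\left(\frac{\exp(w_k^\top h_{k,i})}{\sum_{j=1}^{K}\exp(w_j^\top h_{k,i})}\right)$$ be the cross-entropy loss of the unconstrained layer-peeled model (ULPM). Let $(W(t),H(t))$, $t\in[0,\infty)$, be a solution of the gradient flow $$\frac{dW}{dt}=-\frac{\partial\mathcal{L}}{\partial W}(W(t),H(t)),\qquad \frac{dH}{dt}=-\frac{\partial\mathcal{L}}{\partial H}(W(t),H(t)),$$ and suppose that $\mathcal{L}(W(t_0),H(t_0))<\log 2$ for some $t_0\ge 0$. Then every limit point, as $t\to\infty$, of the normalized trajectory $$\frac{(W(t),H(t))}{\sqrt{\|W(t)\|_F^2+\|H(t)\|_F^2}}$$ is a positive multiple of a Karush-Kuhn-Tucker (KKT) point of the minimum-norm separation problem $$\min_{W,H}\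 \tfrac12\|W\|_F^2+\tfrac12\|H\|_F^2\quad\text{subject to}\quad w_k^\top h_{k,i}-w_j^\top h_{k,i}\ge 1\quad\text{for all }k\ne j\in\{1,\dots,K\},\ i\in\{1,\dots,n\}.$$ Here a KKT point of the problem of minimizing a differentiable function $f(x)$ subject to differentiable constraints $g_l(x)\le 0$ is a feasible point $x$ for which there exist multipliers $\lambda_l\ge 0$ with $\nabla f(x)+\sum_l\lambda_l\nabla g_l(x)=0$ and $\lambda_l g_l(x)=0$ for all $l$. -/

import Mathlib

open Filter Topology Set
open scoped Gradient

noncomputable section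

namespace ULPM

/-- The parameter space of vectors `θ = vec(W, H)` for `K` classes, `n` samples per class and
feature dimension `d`, with the Euclidean inner product of all entries of `W` and `H`. -/
abbrev Params (K n d : ℕ) : Type :=
  EuclideanSpace ℝ ((Fin K × Fin d) ⊕ (Fin d × (Fin K × Fin n)))

/-- The classifier matrix `W ∈ ℝ^{K × d}` of `θ`; its `k`-th row is `w_k`. -/
def W {K n d : ℕ} (θ : Params K n d) : Matrix (Fin K) (Fin d) ℝ :=
  Matrix.of fun k a => θ (Sum.inl (k, a))

/-- The feature matrix `H ∈ ℝ^{d × Kn}` of `θ`; its column with index `(k, i)` is `h_{k,i}`. -/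
def H {K n d : ℕ} (θ : Params K n d) : Matrix (Fin d) (Fin K × Fin n) ℝ :=
  Matrix.of fun a c => θ (Sum.inr (a, c))

/-- The squared Frobenius norm of a real matrix. -/
def frobSq {m l : Type*} [Fintype m] [Fintype l] (A : Matrix m l ℝ) : ℝ :=
  ∑ r : m, ∑ c : l, A r c ^ 2

/-- The logit `w_j ⬝ h_{k,i}` of the `i`-th sample of class `k` for the label `j`. -/
def logit {K n d : ℕ} (θ : Params K n d) (j k : Fin K) (i : Fin n) : ℝ :=
  (W θ).row j ⬝ᵥ (H θ).col (k, i)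

/-- The cross-entropy loss of the unconstrained layer-peeled model. -/
def loss {K n d : ℕ} (θ : Params K n d) : ℝ :=
  -∑ k : Fin K, ∑ i : Fin n,
    Real.log (Real.exp (logit θ k k i) / ∑ j : Fin K, Real.exp (logit θ j k i))

/-- `θ : [0, ∞) → Params K n d` solves the gradient flow `θ' = -∇ L(θ)` of the loss (the derivative
at time `0` is one-sided; values at negative times play no role). -/
def IsGradientFlow {K n d : ℕ} (θ : ℝ → Params K n d) : Prop :=
  ∀ t : ℝ, 0 ≤ t → HasDerivWithinAt θ (-(∇ (loss (K := K) (n := n) (d := d)) (θ t))) (Ici 0) t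

/-- The normalized parameters `(W, H) / √(‖W‖_F² + ‖H‖_F²)`. -/
def normalized {K n d : ℕ} (θ : Params K n d) : Params K n d :=
  (Real.sqrt (frobSq (W θ) + frobSq (H θ)))⁻¹ • θ

/-- `x` is a Karush-Kuhn-Tucker point of the problem of minimizing `f` subject to `g i ≤ 0` for all
`i`, where `f` and all `g i` are differentiable. -/
def IsKKTPoint {E ι : Type*} [NormedAddCommGroup E] [InnerProductSpace ℝ E] [CompleteSpace E]
    [Fintype ι] (f : E → ℝ) (g : ι → E → ℝ) (x : E) : Prop :=
  (∀ i, g i x ≤ 0) ∧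
    ∃ μ : ι → ℝ, (∀ i, 0 ≤ μ i) ∧ ∇ f x + ∑ i, μ i • ∇ (g i) x = 0 ∧ ∀ i, μ i * g i x = 0

/-- The objective `½‖W‖_F² + ½‖H‖_F²` of the minimum-norm separation problem. -/
def sepObjective {K n d : ℕ} (θ : Params K n d) : ℝ :=
  1 / 2 * frobSq (W θ) + 1 / 2 * frobSq (H θ)

/-- The index set of the separation constraints: triples `(k, j, i)` with `k ≠ j`. -/
abbrev SepIndex (K n : ℕ) : Type :=
  {p : Fin K × Fin K × Fin n // p.1 ≠ p.2.1}

/-- The constraint `w_k ⬝ h_{k,i} - w_j ⬝ h_{k,i} ≥ 1`, in the standard form `g ≤ 0`, for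
`p = (k, j, i)`. -/
def sepConstraint {K n d : ℕ} (p : SepIndex K n) (θ : Params K n d) : ℝ :=
  1 - (logit θ p.1.1 p.1.1 p.1.2.2 - logit θ p.1.2.1 p.1.1 p.1.2.2)

/-- `(W, H)` is a KKT point of the minimum-norm separation problem: minimize `½‖W‖_F² + ½‖H‖_F²`
subject to `w_k ⬝ h_{k,i} - w_j ⬝ h_{k,i} ≥ 1` for all `k ≠ j` and all `i`. -/
def IsSepKKTPoint {K n d : ℕ} (θ : Params K n d) : Prop :=
  IsKKTPoint sepObjective (sepConstraint (K := K) (n := n) (d := d)) θ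

end ULPM

end

/-!
Write `q p` for the margins, homogeneous of degree `L` in the parameters `θ`, and `ℓ` for the
logistic loss. In the time scale `log ‖θ‖` the direction `θ / ‖θ‖` moves with a speed `D` that
measures how far `-∇ ℓ` is from being radial, while the logarithm of the normalized soft margin
`-log (exp ℓ - 1) / ‖θ‖ ^ L` grows at a rate of at least `D ^ 2`. This quantity is bounded, since
homogeneous margins are bounded on the unit sphere, whereas `‖θ‖ → ∞`; hence late times at which
`D` is arbitrarily small occur near every limit direction. At such a time the softmax weights,
rescaled by `‖θ‖ ^ L / ⟪θ, -∇ ℓ⟫`, satisfy the stationarity equation up to an error `D`. They are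
bounded, and as `‖θ‖ → ∞` they concentrate exponentially on the smallest margins. An ultrafilter
limit therefore consists of Lagrange multipliers at the limit direction, which homogeneity rescales
to a point whose smallest margin is `1`.
-/

noncomputable section

namespace HomogeneousLogistic

open scoped RealInnerProductSpace

section MeanValue

lemma sub_le_sub_of_deriv_le {f f' g g' : ℝ → ℝ} {a b : ℝ} {S : Set ℝ} (hab : a ≤ b)
    (hS : Icc a b ⊆ S) (hf : ∀ t ∈ S, HasDerivWithinAt f (f' t) S t)
    (hg : ∀ t ∈ S, HasDerivWithinAt g (g' t) S t) (hle : ∀ t ∈ Icc a b, f' t ≤ g' t) :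
    f b - f a ≤ g b - g a := by
  have hderiv : ∀ t ∈ S, HasDerivWithinAt (fun t => g t - f t) (g' t - f' t) S t :=
    fun t ht => (hg t ht).sub (hf t ht)
  have hmono : MonotoneOn (fun t => g t - f t) (Icc a b) :=
    monotoneOn_of_hasDerivWithinAt_nonneg (convex_Icc a b)
      (fun t ht => (hderiv t (hS ht)).continuousWithinAt.mono hS)
      (fun t ht => (hderiv t (hS (interior_subset ht))).mono (interior_subset.trans hS))
      (fun t ht => sub_nonneg.2 (hle t (interior_subset ht)))
  linarith [hmono (left_mem_Icc.2 hab) (right_mem_Icc.2 hab) hab]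

lemma norm_sub_le_sub_of_norm_deriv_le {F : Type*} [NormedAddCommGroup F] [NormedSpace ℝ F]
    {f f' : ℝ → F} {g g' : ℝ → ℝ} {a b : ℝ} {S : Set ℝ} (hab : a ≤ b) (hS : Icc a b ⊆ S)
    (hf : ∀ t ∈ S, HasDerivWithinAt f (f' t) S t) (hg : ∀ t ∈ S, HasDerivWithinAt g (g' t) S t)
    (hle : ∀ t ∈ Icc a b, ‖f' t‖ ≤ g' t) : ‖f b - f a‖ ≤ g b - g a := by
  have hnhds : ∀ t ∈ Ico a b, S ∈ 𝓝[≥] t := fun t ht =>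
    mem_of_superset (Icc_mem_nhdsGE_of_mem ht) hS
  refine image_norm_le_of_norm_deriv_right_le_deriv_boundary' (f := fun t => f t - f a)
    (B := fun t => g t - g a) (f' := f') (B' := g') ?_ ?_ (by simp) ?_ ?_ ?_ (right_mem_Icc.2 hab)
  · exact fun t ht => ((hf t (hS ht)).continuousWithinAt.mono hS).sub continuousWithinAt_const
  · exact fun t ht => ((hf t (hS (Ico_subset_Icc_self ht))).mono_of_mem_nhdsWithin
      (hnhds t ht)).sub_const _
  · exact fun t ht => ((hg t (hS ht)).continuousWithinAt.mono hS).sub continuousWithinAt_const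
  · exact fun t ht => ((hg t (hS (Ico_subset_Icc_self ht))).mono_of_mem_nhdsWithin
      (hnhds t ht)).sub_const _
  · exact fun t ht => hle t (Ico_subset_Icc_self ht)

end MeanValue

section Homogeneous

variable {E F : Type*} [NormedAddCommGroup E] [NormedSpace ℝ E] [NormedAddCommGroup F]
  [NormedSpace ℝ F] {L : ℕ}

/-- Positive homogeneity of degree `L`, as for the margins of a network in terms of its weights. The
degree is a natural number, which keeps real powers out of the scaling. -/
def PosHomogeneous (L : ℕ) (f : E → F) : Prop :=
  ∀ ⦃c : ℝ⦄, 0 < c → ∀ x, f (c • x) = c ^ L • f x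

namespace PosHomogeneous

lemma norm_pow_smul_normalize {f : E → F} (hf : PosHomogeneous L f) {x : E} (hx : x ≠ 0) :
    ‖x‖ ^ L • f (NormedSpace.normalize x) = f x := by
  rw [← hf (norm_pos_iff.2 hx), NormedSpace.norm_smul_normalize]

lemma fderiv_apply_self {f : E → F} (hf : PosHomogeneous L f) {x : E}
    (hx : DifferentiableAt ℝ f x) : fderiv ℝ f x x = (L : ℝ) • f x := by
  have hray : HasDerivAt (fun c : ℝ => f (c • x)) (fderiv ℝ f x x) 1 := by
    have hsmul : HasDerivAt (fun c : ℝ => c • x) x 1 := by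
      simpa using (hasDerivAt_id (1 : ℝ)).smul_const x
    refine HasFDerivAt.comp_hasDerivAt (1 : ℝ) ?_ hsmul
    simpa only [one_smul] using hx.hasFDerivAt
  have hpow : HasDerivAt (fun c : ℝ => c ^ L • f x) ((L : ℝ) • f x) 1 := by
    simpa using (hasDerivAt_pow L (1 : ℝ)).smul_const (f x)
  refine hray.unique (hpow.congr_of_eventuallyEq ?_)
  filter_upwards [lt_mem_nhds (zero_lt_one' ℝ)] with c hc using hf hc x

lemma smul_fderiv {f : E → F} (hf : PosHomogeneous L f) {c : ℝ} (hc : 0 < c) (x : E) :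
    c • fderiv ℝ f (c • x) = c ^ L • fderiv ℝ f x := by
  have hfun : (f <| c • ·) = c ^ L • f := funext fun y => hf hc y
  rw [← fderiv_comp_smul, hfun, fderiv_const_smul_field, Pi.smul_apply]

lemma exists_norm_le {f : E → F} (hf : PosHomogeneous L f) (hcont : ContinuousAt f 0) :
    ∃ C > 0, ∀ x ≠ 0, ‖f x‖ ≤ C * ‖x‖ ^ L := by
  obtain ⟨δ, hδ, hball⟩ := Metric.eventually_nhds_iff_ball.1
    (hcont.norm.eventually_le_const (lt_add_one ‖f 0‖))
  refine ⟨(‖f 0‖ + 1) / (δ / 2) ^ L, by positivity, fun x hx => ?_⟩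
  have hx0 : 0 < ‖x‖ := norm_pos_iff.2 hx
  have hmem : ‖f ((δ / 2 / ‖x‖) • x)‖ ≤ ‖f 0‖ + 1 := by
    refine hball _ ?_
    rw [mem_ball_zero_iff, norm_smul, Real.norm_of_nonneg (by positivity),
      div_mul_cancel₀ _ hx0.ne']
    exact half_lt_self hδ
  rw [hf (by positivity), norm_smul, Real.norm_of_nonneg (by positivity), div_pow,
    div_mul_eq_mul_div, div_le_iff₀ (by positivity)] at hmem
  rw [div_mul_eq_mul_div, le_div_iff₀ (by positivity)]
  linarith

end PosHomogeneous

end Homogeneous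

section HomogeneousGradient

variable {E : Type*} [NormedAddCommGroup E] [InnerProductSpace ℝ E] [CompleteSpace E] {L : ℕ}
  {f : E → ℝ}

namespace PosHomogeneous

lemma inner_gradient_self (hf : PosHomogeneous L f) {x : E} (hx : DifferentiableAt ℝ f x) :
    ⟪∇ f x, x⟫ = L * f x := by
  rw [inner_gradient_left, hf.fderiv_apply_self hx, smul_eq_mul]

lemma smul_gradient (hf : PosHomogeneous L f) {c : ℝ} (hc : 0 < c) (x : E) :
    c • ∇ f (c • x) = c ^ L • ∇ f x := by
  refine ext_inner_right ℝ fun y => ?_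
  simp only [real_inner_smul_left, inner_gradient_left]
  exact DFunLike.congr_fun (hf.smul_fderiv hc x) y

lemma norm_pow_smul_gradient_normalize (hf : PosHomogeneous L f) {x : E} (hx : x ≠ 0) :
    ‖x‖ ^ L • ∇ f (NormedSpace.normalize x) = ‖x‖ • ∇ f x := by
  rw [← hf.smul_gradient (norm_pos_iff.2 hx), NormedSpace.norm_smul_normalize]

end PosHomogeneous

end HomogeneousGradient

section Radial

variable {E : Type*} [NormedAddCommGroup E] [InnerProductSpace ℝ E]

/-- The tangent of the angle between `x` and `v` (for `0 < ⟪x, v⟫`): the distance of `v` to the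
radial direction at `x` once `v` is rescaled to have radial part `normalize x`. -/
def radialDeviation (x v : E) : ℝ := ‖(‖x‖ / ⟪x, v⟫) • v - NormedSpace.normalize x‖

lemma radialDeviation_sq {x v : E} (hxv : ⟪x, v⟫ ≠ 0) :
    radialDeviation x v ^ 2 = ‖x‖ ^ 2 * ‖v‖ ^ 2 / ⟪x, v⟫ ^ 2 - 1 := by
  have hx : x ≠ 0 := by rintro rfl; simp at hxv
  have hnorm : ‖x‖ ≠ 0 := norm_ne_zero_iff.2 hx
  rw [radialDeviation, norm_sub_sq_real, NormedSpace.norm_normalize hx, norm_smul,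
    NormedSpace.normalize, real_inner_smul_left, real_inner_smul_right, real_inner_comm x v,
    mul_pow, Real.norm_eq_abs, sq_abs]
  field_simp
  ring

variable {θ : ℝ → E} {v : E} {S : Set ℝ} {t : ℝ}

lemma hasDerivWithinAt_norm (hθ : HasDerivWithinAt θ v S t) (h0 : θ t ≠ 0) :
    HasDerivWithinAt (fun u => ‖θ u‖) (⟪θ t, v⟫ / ‖θ t‖) S t := by
  have hsqrt := hθ.norm_sq.sqrt (pow_ne_zero 2 (norm_ne_zero_iff.2 h0))
  simp only [Real.sqrt_sq (norm_nonneg _)] at hsqrt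
  exact hsqrt.congr_deriv (mul_div_mul_left _ _ two_ne_zero)

lemma hasDerivWithinAt_log_norm (hθ : HasDerivWithinAt θ v S t) (h0 : θ t ≠ 0) :
    HasDerivWithinAt (fun u => Real.log ‖θ u‖) (⟪θ t, v⟫ / ‖θ t‖ ^ 2) S t :=
  ((hasDerivWithinAt_norm hθ h0).log (norm_ne_zero_iff.2 h0)).congr_deriv
    (by rw [div_div, sq])

lemma hasDerivWithinAt_normalize (hθ : HasDerivWithinAt θ v S t) (hv : ⟪θ t, v⟫ ≠ 0) :
    HasDerivWithinAt (fun u => NormedSpace.normalize (θ u))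
      ((⟪θ t, v⟫ / ‖θ t‖ ^ 2) • ((‖θ t‖ / ⟪θ t, v⟫) • v - NormedSpace.normalize (θ t))) S t := by
  have h0 : θ t ≠ 0 := fun h => hv (by rw [h, inner_zero_left])
  have hnorm : ‖θ t‖ ≠ 0 := norm_ne_zero_iff.2 h0
  refine (((hasDerivWithinAt_norm hθ h0).inv hnorm).smul hθ).congr_deriv ?_
  simp only [NormedSpace.normalize, Pi.inv_apply]
  match_scalars <;> field_simp

end Radial

section LogisticLoss

variable {X ι N : Type*}

lemma one_sub_prod_one_sub_le_sum (S : Finset N) {f : N → ℝ} (h0 : ∀ m ∈ S, 0 ≤ f m)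
    (h1 : ∀ m ∈ S, f m ≤ 1) : 1 - ∏ m ∈ S, (1 - f m) ≤ ∑ m ∈ S, f m := by
  classical
  induction S using Finset.induction_on with
  | empty => simp
  | insert a S ha ih =>
    rw [Finset.forall_mem_insert] at h0 h1
    rw [Finset.prod_insert ha, Finset.sum_insert ha]
    have hprod : ∏ m ∈ S, (1 - f m) ≤ 1 := Finset.prod_le_one
      (fun m hm => sub_nonneg.2 (h1.2 m hm)) (fun m hm => sub_le_self 1 (h0.2 m hm))
    nlinarith [ih h0.2 h1.2, h0.1]

variable [Fintype ι] [DecidableEq N] (q : ι → X → ℝ) (s : ι → N)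

/-- The sum of the exponentials of the negated margins of the sample `m`; `q p x` is the `p`-th
margin of the parameters `x`, and it belongs to the sample `s p`. -/
def expSum (m : N) (x : X) : ℝ := ∑ p with s p = m, Real.exp (-q p x)

/-- The softmax weight that the `p`-th margin carries in the gradient of `logisticLoss`. -/
def weight (p : ι) (x : X) : ℝ := Real.exp (-q p x) / (1 + expSum q s (s p) x)

variable {q s} {x : X}

lemma expSum_nonneg (m : N) : 0 ≤ expSum q s m x :=
  Finset.sum_nonneg fun _ _ => (Real.exp_pos _).le

lemma one_add_expSum_pos (m : N) : 0 < 1 + expSum q s m x :=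
  add_pos_of_pos_of_nonneg one_pos (expSum_nonneg m)

lemma weight_pos (p : ι) : 0 < weight q s p x :=
  div_pos (Real.exp_pos _) (one_add_expSum_pos _)

lemma weight_le_exp_neg (p : ι) : weight q s p x ≤ Real.exp (-q p x) :=
  div_le_self (Real.exp_pos _).le (le_add_of_nonneg_right (expSum_nonneg _))

lemma exp_neg_le_expSum (p : ι) : Real.exp (-q p x) ≤ expSum q s (s p) x :=
  Finset.single_le_sum (f := fun p => Real.exp (-q p x)) (fun _ _ => (Real.exp_pos _).le)
    (by simp)

variable [Fintype N] (q s)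

/-- The logistic loss `∑ₘ log (1 + ∑_{s p = m} exp (-q p))` of a family of margins `q` grouped into
samples by `s`; with margins `wₖ ⬝ h - wⱼ ⬝ h` it is the multiclass cross-entropy. -/
def logisticLoss (x : X) : ℝ := ∑ m, Real.log (1 + expSum q s m x)

/-- The smooth lower bound `-log (exp ℓ - 1)` of all margins, where `ℓ` is the logistic loss. -/
def softMargin (x : X) : ℝ := -Real.log (Real.exp (logisticLoss q s x) - 1)

variable {q s}

lemma exp_logisticLoss : Real.exp (logisticLoss q s x) = ∏ m, (1 + expSum q s m x) := by
  rw [logisticLoss, Real.exp_sum]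
  exact Finset.prod_congr rfl fun m _ => Real.exp_log (one_add_expSum_pos m)

lemma one_add_expSum_le (m : N) : 1 + expSum q s m x ≤ Real.exp (logisticLoss q s x) := by
  rw [← Real.log_le_iff_le_exp (one_add_expSum_pos m)]
  exact Finset.single_le_sum (f := fun m => Real.log (1 + expSum q s m x))
    (fun m _ => Real.log_nonneg (le_add_of_nonneg_right (expSum_nonneg m))) (Finset.mem_univ m)

lemma exp_neg_le_exp_logisticLoss_sub_one (p : ι) :
    Real.exp (-q p x) ≤ Real.exp (logisticLoss q s x) - 1 := by
  linarith [exp_neg_le_expSum (q := q) (s := s) (x := x) p,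
    one_add_expSum_le (q := q) (s := s) (x := x) (s p)]

lemma softMargin_le (p : ι) : softMargin q s x ≤ q p x := by
  rw [softMargin, neg_le, Real.le_log_iff_exp_le]
  · exact exp_neg_le_exp_logisticLoss_sub_one p
  · exact (Real.exp_pos _).trans_le (exp_neg_le_exp_logisticLoss_sub_one p)

lemma sum_weight :
    ∑ p, weight q s p x = ∑ m, expSum q s m x / (1 + expSum q s m x) := by
  rw [← Finset.sum_fiberwise Finset.univ s]
  refine Finset.sum_congr rfl fun m _ => ?_
  rw [expSum, Finset.sum_div]
  refine Finset.sum_congr rfl fun p hp => ?_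
  rw [weight, (Finset.mem_filter.1 hp).2, expSum]

lemma one_sub_exp_neg_logisticLoss_le :
    1 - Real.exp (-logisticLoss q s x) ≤ ∑ p, weight q s p x := by
  have hinv : ∀ m, (1 + expSum q s m x)⁻¹ = 1 - expSum q s m x / (1 + expSum q s m x) := by
    intro m
    have := (one_add_expSum_pos (q := q) (s := s) (x := x) m).ne'
    field_simp
    ring
  rw [sum_weight, Real.exp_neg, exp_logisticLoss, ← Finset.prod_inv_distrib]
  simp only [hinv]
  exact one_sub_prod_one_sub_le_sum _
    (fun m _ => div_nonneg (expSum_nonneg m) (one_add_expSum_pos m).le)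
    (fun m _ => (div_le_one (one_add_expSum_pos m)).2 (le_add_of_nonneg_left zero_le_one))

lemma exp_logisticLoss_sub_one_lt_one (hx : logisticLoss q s x < Real.log 2) :
    Real.exp (logisticLoss q s x) - 1 < 1 := by
  linarith [(Real.lt_log_iff_exp_lt two_pos).1 hx]

lemma exp_neg_le_two_mul_weight (hx : logisticLoss q s x < Real.log 2) (p : ι) :
    Real.exp (-q p x) ≤ 2 * weight q s p x := by
  rw [weight, ← mul_div_assoc, le_div_iff₀ (one_add_expSum_pos _), mul_comm]
  refine mul_le_mul_of_nonneg_right ?_ (Real.exp_pos _).le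
  linarith [one_add_expSum_le (q := q) (s := s) (x := x) (s p),
    exp_logisticLoss_sub_one_lt_one hx]

variable [Nonempty ι]

lemma exp_logisticLoss_sub_one_pos : 0 < Real.exp (logisticLoss q s x) - 1 :=
  (Real.exp_pos _).trans_le (exp_neg_le_exp_logisticLoss_sub_one (Classical.arbitrary ι))

lemma logisticLoss_pos : 0 < logisticLoss q s x :=
  Real.one_lt_exp_iff.1 (sub_pos.1 exp_logisticLoss_sub_one_pos)

lemma one_sub_exp_neg_logisticLoss_pos : 0 < 1 - Real.exp (-logisticLoss q s x) :=
  sub_pos.2 (Real.exp_lt_one_iff.2 (neg_neg_of_pos logisticLoss_pos))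

lemma softMargin_pos (hx : logisticLoss q s x < Real.log 2) : 0 < softMargin q s x :=
  neg_pos.2 (Real.log_neg exp_logisticLoss_sub_one_pos (exp_logisticLoss_sub_one_lt_one hx))

lemma softMargin_le_softMargin {y : X} (hxy : logisticLoss q s y ≤ logisticLoss q s x) :
    softMargin q s x ≤ softMargin q s y :=
  neg_le_neg (Real.log_le_log exp_logisticLoss_sub_one_pos
    (sub_le_sub_right (Real.exp_le_exp.2 hxy) 1))

end LogisticLoss

section HomogeneousModel

variable {E ι N : Type*} [NormedAddCommGroup E] [InnerProductSpace ℝ E] {q : ι → E → ℝ}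
  {s : ι → N} {L : ℕ} {x : E}

/-- A family of continuously differentiable margins, homogeneous of a common degree `L`. -/
structure IsHomogeneousModel (q : ι → E → ℝ) (L : ℕ) : Prop where
  contDiff : ∀ p, ContDiff ℝ 1 (q p)
  posHomogeneous : ∀ p, PosHomogeneous L (q p)

lemma IsHomogeneousModel.differentiable (hq : IsHomogeneousModel q L) (p : ι) :
    Differentiable ℝ (q p) :=
  (hq.contDiff p).differentiable one_ne_zero

lemma IsHomogeneousModel.continuous_gradient [CompleteSpace E] (hq : IsHomogeneousModel q L)
    (p : ι) : Continuous (∇ (q p)) :=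
  (InnerProductSpace.toDual ℝ E).symm.continuous.comp
    ((hq.contDiff p).continuous_fderiv one_ne_zero)

variable [Fintype ι] [Fintype N] [DecidableEq N]

/-- The soft margin divided by the scale of the margins. -/
def normalizedMargin (q : ι → E → ℝ) (s : ι → N) (L : ℕ) (x : E) : ℝ :=
  softMargin q s x / ‖x‖ ^ L

lemma IsHomogeneousModel.normalizedMargin_le (hq : IsHomogeneousModel q L) (hx : x ≠ 0) (p : ι) :
    normalizedMargin q s L x ≤ q p (NormedSpace.normalize x) := by
  rw [normalizedMargin, div_le_iff₀' (pow_pos (norm_pos_iff.2 hx) L), ← smul_eq_mul,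
    (hq.posHomogeneous p).norm_pow_smul_normalize hx]
  exact softMargin_le p

variable [CompleteSpace E]

lemma hasGradientAt_logisticLoss (hq : ∀ p, DifferentiableAt ℝ (q p) x) :
    HasGradientAt (logisticLoss q s) (-∑ p, weight q s p x • ∇ (q p) x) x := by
  have hexpSum : ∀ m, HasFDerivAt (expSum q s m)
      (∑ p with s p = m, Real.exp (-q p x) • -fderiv ℝ (q p) x) x := fun m =>
    HasFDerivAt.fun_sum fun p _ => (hq p).hasFDerivAt.neg.exp
  have hloss : HasFDerivAt (logisticLoss q s) (∑ m, (1 + expSum q s m x)⁻¹ •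
      ∑ p with s p = m, Real.exp (-q p x) • -fderiv ℝ (q p) x) x :=
    HasFDerivAt.fun_sum fun m _ => ((hexpSum m).const_add 1).log (one_add_expSum_pos m).ne'
  refine hasGradientAt_iff_hasFDerivAt.2 (hloss.congr_fderiv ?_)
  rw [← Finset.sum_neg_distrib, map_sum, ← Finset.sum_fiberwise Finset.univ s]
  refine Finset.sum_congr rfl fun m _ => ?_
  rw [Finset.smul_sum]
  refine Finset.sum_congr rfl fun p hp => ?_
  rw [weight, (Finset.mem_filter.1 hp).2, map_neg, map_smul, gradient,
    LinearIsometryEquiv.apply_symm_apply, smul_smul, smul_neg, div_eq_inv_mul]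

variable (q s) in
/-- The velocity of the gradient flow of the logistic loss. -/
def descent (x : E) : E := -∇ (logisticLoss q s) x

lemma descent_eq_sum (hq : ∀ p, DifferentiableAt ℝ (q p) x) :
    descent q s x = ∑ p, weight q s p x • ∇ (q p) x := by
  rw [descent, (hasGradientAt_logisticLoss hq).gradient, neg_neg]

namespace IsHomogeneousModel

lemma inner_descent_eq (hq : IsHomogeneousModel q L) (s : ι → N) (x : E) :
    ⟪x, descent q s x⟫ = L * ∑ p, weight q s p x * q p x := by
  rw [descent_eq_sum fun p => hq.differentiable p x, inner_sum, Finset.mul_sum]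
  refine Finset.sum_congr rfl fun p _ => ?_
  rw [real_inner_smul_right, real_inner_comm,
    (hq.posHomogeneous p).inner_gradient_self (hq.differentiable p x)]
  ring

lemma le_inner_descent (hq : IsHomogeneousModel q L) (hx : 0 ≤ softMargin q s x) :
    L * (softMargin q s x * (1 - Real.exp (-logisticLoss q s x))) ≤ ⟪x, descent q s x⟫ := by
  rw [hq.inner_descent_eq]
  refine mul_le_mul_of_nonneg_left ?_ L.cast_nonneg
  calc softMargin q s x * (1 - Real.exp (-logisticLoss q s x))
      ≤ softMargin q s x * ∑ p, weight q s p x :=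
        mul_le_mul_of_nonneg_left one_sub_exp_neg_logisticLoss_le hx
    _ = ∑ p, weight q s p x * softMargin q s x := by rw [mul_comm, Finset.sum_mul]
    _ ≤ ∑ p, weight q s p x * q p x := Finset.sum_le_sum fun p _ =>
        mul_le_mul_of_nonneg_left (softMargin_le p) (weight_pos p).le

variable [Nonempty ι] [NeZero L]

lemma inner_descent_pos (hq : IsHomogeneousModel q L) (hx : logisticLoss q s x < Real.log 2) :
    0 < ⟪x, descent q s x⟫ :=
  (mul_pos (Nat.cast_pos.2 (NeZero.pos L)) (mul_pos (softMargin_pos hx)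
    one_sub_exp_neg_logisticLoss_pos)).trans_le (hq.le_inner_descent (softMargin_pos hx).le)

lemma ne_zero (hq : IsHomogeneousModel q L) (hx : logisticLoss q s x < Real.log 2) : x ≠ 0 := by
  rintro rfl
  simpa using hq.inner_descent_pos hx

lemma inner_descent_div_pos (hq : IsHomogeneousModel q L)
    (hx : logisticLoss q s x < Real.log 2) : 0 < ⟪x, descent q s x⟫ / ‖x‖ ^ 2 :=
  div_pos (hq.inner_descent_pos hx) (pow_pos (norm_pos_iff.2 (hq.ne_zero hx)) 2)

/-- The right-hand side is the rate of change of the logarithm of `normalizedMargin` along the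
flow, and `⟪x, descent q s x⟫ / ‖x‖ ^ 2` is that of `log ‖x‖`. -/
lemma radialDeviation_sq_mul_le (hq : IsHomogeneousModel q L)
    (hx : logisticLoss q s x < Real.log 2) :
    radialDeviation x (descent q s x) ^ 2 * (⟪x, descent q s x⟫ / ‖x‖ ^ 2) ≤
      ‖descent q s x‖ ^ 2 / (softMargin q s x * (1 - Real.exp (-logisticLoss q s x))) -
        L * (⟪x, descent q s x⟫ / ‖x‖ ^ 2) := by
  have hnorm : ‖x‖ ≠ 0 := norm_ne_zero_iff.2 (hq.ne_zero hx)
  have hL : (1 : ℝ) ≤ L := Nat.one_le_cast.2 (NeZero.one_le)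
  have hden : 0 < softMargin q s x * (1 - Real.exp (-logisticLoss q s x)) :=
    mul_pos (softMargin_pos hx) one_sub_exp_neg_logisticLoss_pos
  have hle := hq.le_inner_descent (softMargin_pos hx).le
  have hdev := mul_nonneg (sq_nonneg (radialDeviation x (descent q s x)))
    (hq.inner_descent_div_pos hx).le
  set v := descent q s x
  have hxv : 0 < ⟪x, v⟫ := hq.inner_descent_pos hx
  calc radialDeviation x v ^ 2 * (⟪x, v⟫ / ‖x‖ ^ 2)
      ≤ L * (radialDeviation x v ^ 2 * (⟪x, v⟫ / ‖x‖ ^ 2)) := le_mul_of_one_le_left hdev hL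
    _ = ‖v‖ ^ 2 / (⟪x, v⟫ / L) - L * (⟪x, v⟫ / ‖x‖ ^ 2) := by
        rw [radialDeviation_sq hxv.ne']
        field_simp
    _ ≤ _ := by
        gcongr
        exact (le_div_iff₀' (by positivity)).2 hle

lemma normalizedMargin_pos (hq : IsHomogeneousModel q L) (hx : logisticLoss q s x < Real.log 2) :
    0 < normalizedMargin q s L x :=
  div_pos (softMargin_pos hx) (pow_pos (norm_pos_iff.2 (hq.ne_zero hx)) L)

end IsHomogeneousModel

end HomogeneousModel

/-- `θ` follows the gradient flow of the logistic loss of a homogeneous model from the time `t₀` on,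
and starts with a loss below `log 2`, which makes all its margins positive. -/
structure IsSeparatingFlow {E ι N : Type*} [NormedAddCommGroup E] [InnerProductSpace ℝ E]
    [CompleteSpace E] [Fintype ι] [Fintype N] [DecidableEq N] (q : ι → E → ℝ) (s : ι → N) (L : ℕ)
    (θ : ℝ → E) (t₀ : ℝ) : Prop extends IsHomogeneousModel q L where
  hasDerivWithinAt : ∀ t ∈ Ici t₀, HasDerivWithinAt θ (descent q s (θ t)) (Ici t₀) t
  logisticLoss_lt : logisticLoss q s (θ t₀) < Real.log 2

namespace IsSeparatingFlow

variable {E ι N : Type*} [NormedAddCommGroup E] [InnerProductSpace ℝ E] [CompleteSpace E]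
  [Fintype ι] [Fintype N] [DecidableEq N] {q : ι → E → ℝ} {s : ι → N} {L : ℕ} {θ : ℝ → E}
  {t₀ a b t : ℝ}

lemma hasDerivWithinAt_logisticLoss (hθ : IsSeparatingFlow q s L θ t₀) (ht : t ∈ Ici t₀) :
    HasDerivWithinAt (fun t => logisticLoss q s (θ t)) (-‖descent q s (θ t)‖ ^ 2) (Ici t₀) t := by
  have hgrad := hasGradientAt_logisticLoss (q := q) (s := s) fun p => hθ.differentiable p (θ t)
  rw [← descent_eq_sum fun p => hθ.differentiable p (θ t)] at hgrad
  refine (hgrad.hasFDerivAt.comp_hasDerivWithinAt t (hθ.hasDerivWithinAt t ht)).congr_deriv ?_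
  rw [InnerProductSpace.toDual_apply_apply, inner_neg_left, real_inner_self_eq_norm_sq]

lemma logisticLoss_antitoneOn (hθ : IsSeparatingFlow q s L θ t₀) :
    AntitoneOn (fun t => logisticLoss q s (θ t)) (Ici t₀) := fun a ha b _ hab => by
  have hdecrease := sub_le_sub_of_deriv_le hab (fun t ht => le_trans ha ht.1)
    (fun t ht => hθ.hasDerivWithinAt_logisticLoss ht)
    (fun t _ => hasDerivWithinAt_const t (Ici t₀) (0 : ℝ))
    (fun t _ => neg_nonpos.2 (sq_nonneg ‖descent q s (θ t)‖))
  linarith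

lemma logisticLoss_lt_log_two (hθ : IsSeparatingFlow q s L θ t₀) (ht : t ∈ Ici t₀) :
    logisticLoss q s (θ t) < Real.log 2 :=
  (hθ.logisticLoss_antitoneOn self_mem_Ici ht ht).trans_lt hθ.logisticLoss_lt

variable [Nonempty ι]

lemma hasDerivWithinAt_log_softMargin (hθ : IsSeparatingFlow q s L θ t₀) (ht : t ∈ Ici t₀) :
    HasDerivWithinAt (fun t => Real.log (softMargin q s (θ t)))
      (‖descent q s (θ t)‖ ^ 2 /
        (softMargin q s (θ t) * (1 - Real.exp (-logisticLoss q s (θ t))))) (Ici t₀) t := by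
  have hG := softMargin_pos (hθ.logisticLoss_lt_log_two ht)
  have hM := exp_logisticLoss_sub_one_pos (q := q) (s := s) (x := θ t)
  have hE : 1 - Real.exp (-logisticLoss q s (θ t)) =
      (Real.exp (logisticLoss q s (θ t)) - 1) / Real.exp (logisticLoss q s (θ t)) := by
    rw [Real.exp_neg]
    field_simp
  have hderiv : HasDerivWithinAt (fun t => softMargin q s (θ t)) _ (Ici t₀) t :=
    (((hθ.hasDerivWithinAt_logisticLoss ht).exp.sub_const 1).log hM.ne').neg
  refine (hderiv.log hG.ne').congr_deriv ?_
  rw [hE]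
  field_simp

variable [NeZero L]

lemma flow_ne_zero (hθ : IsSeparatingFlow q s L θ t₀) (ht : t ∈ Ici t₀) : θ t ≠ 0 :=
  hθ.ne_zero (hθ.logisticLoss_lt_log_two ht)

lemma hasDerivWithinAt_log_norm (hθ : IsSeparatingFlow q s L θ t₀) (ht : t ∈ Ici t₀) :
    HasDerivWithinAt (fun t => Real.log ‖θ t‖) (⟪θ t, descent q s (θ t)⟫ / ‖θ t‖ ^ 2)
      (Ici t₀) t :=
  HomogeneousLogistic.hasDerivWithinAt_log_norm (hθ.hasDerivWithinAt t ht) (hθ.flow_ne_zero ht)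

lemma hasDerivWithinAt_log_normalizedMargin (hθ : IsSeparatingFlow q s L θ t₀) (ht : t ∈ Ici t₀) :
    HasDerivWithinAt (fun t => Real.log (normalizedMargin q s L (θ t)))
      (‖descent q s (θ t)‖ ^ 2 /
          (softMargin q s (θ t) * (1 - Real.exp (-logisticLoss q s (θ t)))) -
        L * (⟪θ t, descent q s (θ t)⟫ / ‖θ t‖ ^ 2)) (Ici t₀) t := by
  refine ((hθ.hasDerivWithinAt_log_softMargin ht).sub
    ((hθ.hasDerivWithinAt_log_norm ht).const_mul (L : ℝ))).congr_of_mem (fun u hu => ?_) ht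
  rw [normalizedMargin, Real.log_div (softMargin_pos (hθ.logisticLoss_lt_log_two hu)).ne'
    (pow_ne_zero L (norm_ne_zero_iff.2 (hθ.flow_ne_zero hu))), Real.log_pow]
  rfl

lemma mul_log_norm_sub_le (hθ : IsSeparatingFlow q s L θ t₀) (ha : a ∈ Ici t₀) (hab : a ≤ b)
    {η : ℝ} (hη : ∀ t ∈ Icc a b, η ≤ radialDeviation (θ t) (descent q s (θ t)) ^ 2) :
    η * (Real.log ‖θ b‖ - Real.log ‖θ a‖) ≤
      Real.log (normalizedMargin q s L (θ b)) - Real.log (normalizedMargin q s L (θ a)) := by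
  have hsub : Icc a b ⊆ Ici t₀ := fun t ht => le_trans ha ht.1
  rw [mul_sub]
  refine sub_le_sub_of_deriv_le hab hsub
    (fun t ht => (hθ.hasDerivWithinAt_log_norm ht).const_mul η)
    (fun t ht => hθ.hasDerivWithinAt_log_normalizedMargin ht) (fun t ht => ?_)
  have hloss := hθ.logisticLoss_lt_log_two (hsub ht)
  exact (mul_le_mul_of_nonneg_right (hη t ht) (hθ.inner_descent_div_pos hloss).le).trans
    (hθ.radialDeviation_sq_mul_le hloss)

lemma log_normalizedMargin_monotoneOn (hθ : IsSeparatingFlow q s L θ t₀) :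
    MonotoneOn (fun t => Real.log (normalizedMargin q s L (θ t))) (Ici t₀) := fun a ha b _ hab => by
  have hnonneg := hθ.mul_log_norm_sub_le ha hab fun t _ => sq_nonneg _
  rwa [zero_mul, sub_nonneg] at hnonneg

lemma normalizedMargin_monotoneOn (hθ : IsSeparatingFlow q s L θ t₀) :
    MonotoneOn (fun t => normalizedMargin q s L (θ t)) (Ici t₀) := fun _ ha _ hb hab =>
  (Real.log_le_log_iff (hθ.normalizedMargin_pos (hθ.logisticLoss_lt_log_two ha))
    (hθ.normalizedMargin_pos (hθ.logisticLoss_lt_log_two hb))).1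
    (hθ.log_normalizedMargin_monotoneOn ha hb hab)

lemma log_norm_monotoneOn (hθ : IsSeparatingFlow q s L θ t₀) :
    MonotoneOn (fun t => Real.log ‖θ t‖) (Ici t₀) := fun a ha b _ hab => by
  have hsub : Icc a b ⊆ Ici t₀ := fun t ht => le_trans ha ht.1
  have hincrease := sub_le_sub_of_deriv_le hab hsub
    (fun t _ => hasDerivWithinAt_const t (Ici t₀) (0 : ℝ))
    (fun t ht => hθ.hasDerivWithinAt_log_norm ht)
    (fun t ht => (hθ.inner_descent_div_pos (hθ.logisticLoss_lt_log_two (hsub ht))).le)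
  linarith

lemma norm_monotoneOn (hθ : IsSeparatingFlow q s L θ t₀) :
    MonotoneOn (fun t => ‖θ t‖) (Ici t₀) := fun _ ha _ hb hab =>
  (Real.log_le_log_iff (norm_pos_iff.2 (hθ.flow_ne_zero ha))
    (norm_pos_iff.2 (hθ.flow_ne_zero hb))).1 (hθ.log_norm_monotoneOn ha hb hab)

lemma norm_normalize_sub_le (hθ : IsSeparatingFlow q s L θ t₀) (ha : a ∈ Ici t₀) (hab : a ≤ b)
    {δ : ℝ} (hδ : 0 < δ) :
    ‖NormedSpace.normalize (θ b) - NormedSpace.normalize (θ a)‖ ≤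
      δ * (Real.log ‖θ b‖ - Real.log ‖θ a‖) + δ⁻¹ * (Real.log (normalizedMargin q s L (θ b)) -
        Real.log (normalizedMargin q s L (θ a))) := by
  have hsub : Icc a b ⊆ Ici t₀ := fun t ht => le_trans ha ht.1
  have hbound := norm_sub_le_sub_of_norm_deriv_le hab hsub
    (fun t ht => hasDerivWithinAt_normalize (hθ.hasDerivWithinAt t ht)
      (hθ.inner_descent_pos (hθ.logisticLoss_lt_log_two ht)).ne')
    (fun t ht => ((hθ.hasDerivWithinAt_log_norm ht).const_mul δ).add
      ((hθ.hasDerivWithinAt_log_normalizedMargin ht).const_mul δ⁻¹)) (fun t ht => ?_)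
  · simp only [Pi.add_apply] at hbound
    linarith
  · have hloss := hθ.logisticLoss_lt_log_two (hsub ht)
    have hrate := hθ.inner_descent_div_pos hloss
    have hmargin := mul_le_mul_of_nonneg_left (hθ.radialDeviation_sq_mul_le hloss) (inv_pos.2 hδ).le
    rw [norm_smul, Real.norm_of_nonneg hrate.le]
    change _ * radialDeviation (θ t) (descent q s (θ t)) ≤ _
    set D := radialDeviation (θ t) (descent q s (θ t))
    have hyoung : D ≤ δ + δ⁻¹ * D ^ 2 := by
      have hsq : δ + δ⁻¹ * D ^ 2 - D = δ⁻¹ * ((δ - D / 2) ^ 2 + 3 / 4 * D ^ 2) := by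
        field_simp
        ring
      have : 0 ≤ δ⁻¹ * ((δ - D / 2) ^ 2 + 3 / 4 * D ^ 2) := by positivity
      linarith
    linarith [mul_le_mul_of_nonneg_left hyoung hrate.le]

lemma exists_log_normalizedMargin_sub_lt (hθ : IsSeparatingFlow q s L θ t₀) {η : ℝ} (hη : 0 < η) :
    ∃ T ∈ Ici t₀, ∀ a ≥ T, ∀ b ≥ a, Real.log (normalizedMargin q s L (θ b)) -
      Real.log (normalizedMargin q s L (θ a)) < η := by
  set Γ : ℝ → ℝ := fun t => Real.log (normalizedMargin q s L (θ t))
  have hbdd : BddAbove (Γ '' Ici t₀) := by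
    obtain ⟨p⟩ := ‹Nonempty ι›
    obtain ⟨C, -, hle⟩ := (hθ.posHomogeneous p).exists_norm_le
      (hθ.contDiff p).continuous.continuousAt
    refine ⟨Real.log C, forall_mem_image.2 fun t ht => Real.log_le_log
      (hθ.normalizedMargin_pos (hθ.logisticLoss_lt_log_two ht)) ?_⟩
    have hnorm : ‖NormedSpace.normalize (θ t)‖ = 1 :=
      NormedSpace.norm_normalize (hθ.flow_ne_zero ht)
    calc normalizedMargin q s L (θ t) ≤ q p (NormedSpace.normalize (θ t)) :=
          hθ.normalizedMargin_le (hθ.flow_ne_zero ht) p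
      _ ≤ ‖q p (NormedSpace.normalize (θ t))‖ := Real.le_norm_self _
      _ ≤ C := by
          have := hle _ (norm_ne_zero_iff.1 (hnorm ▸ one_ne_zero))
          rwa [hnorm, one_pow, mul_one] at this
  obtain ⟨_, ⟨T, hT, rfl⟩, hlt⟩ := exists_lt_of_lt_csSup (nonempty_Ici.image Γ)
    (sub_lt_self (sSup (Γ '' Ici t₀)) hη)
  refine ⟨T, hT, fun a ha b hb => ?_⟩
  have haT : a ∈ Ici t₀ := le_trans hT ha
  have hmono : Γ T ≤ Γ a := hθ.log_normalizedMargin_monotoneOn hT haT ha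
  have hsup : Γ b ≤ sSup (Γ '' Ici t₀) := le_csSup hbdd (mem_image_of_mem Γ (le_trans haT hb))
  change Γ b - Γ a < η
  linarith

/-- While the norm stays bounded the loss stays away from zero, so the flow keeps pushing
outwards. -/
lemma exists_pos_le_inner_descent (hθ : IsSeparatingFlow q s L θ t₀) {M : ℝ}
    (hM : ∀ t ∈ Ici t₀, ‖θ t‖ ≤ M) : ∃ c > 0, ∀ t ∈ Ici t₀, c ≤ ⟪θ t, descent q s (θ t)⟫ := by
  obtain ⟨p⟩ := ‹Nonempty ι›
  obtain ⟨C, hC, hle⟩ := (hθ.posHomogeneous p).exists_norm_le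
    (hθ.contDiff p).continuous.continuousAt
  have hG := softMargin_pos hθ.logisticLoss_lt
  have hL : (0 : ℝ) < L := Nat.cast_pos.2 (NeZero.pos L)
  refine ⟨L * (softMargin q s (θ t₀) * (1 - (1 + Real.exp (-(C * M ^ L)))⁻¹)), ?_, fun t ht => ?_⟩
  · have hinv : (1 + Real.exp (-(C * M ^ L)))⁻¹ < 1 :=
      inv_lt_one_of_one_lt₀ (lt_add_of_pos_right 1 (Real.exp_pos _))
    exact mul_pos hL (mul_pos hG (sub_pos.2 hinv))
  · have hmargin : q p (θ t) ≤ C * M ^ L :=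
      (Real.le_norm_self _).trans ((hle _ (hθ.flow_ne_zero ht)).trans (by gcongr; exact hM t ht))
    have hexp : Real.exp (-logisticLoss q s (θ t)) ≤ (1 + Real.exp (-(C * M ^ L)))⁻¹ := by
      rw [Real.exp_neg]
      refine inv_anti₀ (by positivity) ?_
      linarith [exp_neg_le_exp_logisticLoss_sub_one (q := q) (s := s) (x := θ t) p,
        Real.exp_le_exp.2 (neg_le_neg hmargin)]
    have hmono : softMargin q s (θ t₀) ≤ softMargin q s (θ t) :=
      softMargin_le_softMargin (hθ.logisticLoss_antitoneOn self_mem_Ici ht ht)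
    refine le_trans ?_ (hθ.le_inner_descent (hG.le.trans hmono))
    gcongr
    · exact sub_nonneg.2 (inv_le_one_of_one_le₀ (by linarith [Real.exp_pos (-(C * M ^ L))]))
    · exact hG.le.trans hmono

lemma tendsto_norm_atTop (hθ : IsSeparatingFlow q s L θ t₀) :
    Tendsto (fun t => ‖θ t‖) atTop atTop := by
  refine tendsto_atTop.2 fun M => ?_
  suffices h : ∃ b ∈ Ici t₀, M ≤ ‖θ b‖ by
    obtain ⟨b, hb, hM⟩ := h
    filter_upwards [eventually_ge_atTop b] with t ht
    exact hM.trans (hθ.norm_monotoneOn hb (le_trans hb ht) ht)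
  by_contra! hM
  obtain ⟨c, hc, hle⟩ := hθ.exists_pos_le_inner_descent fun t ht => (hM t ht).le
  have hgrowth : ∀ t ∈ Ici t₀, 2 * c * (t - t₀) ≤ ‖θ t‖ ^ 2 := fun t ht => by
    have := sub_le_sub_of_deriv_le ht Icc_subset_Ici_self
      (fun u _ => (hasDerivWithinAt_id u _).const_mul (2 * c))
      (fun u hu => (hθ.hasDerivWithinAt u hu).norm_sq)
      (fun u hu => by linarith [hle u hu.1])
    simp only [id_eq] at this
    linarith [sq_nonneg ‖θ t₀‖]
  have ht : t₀ + M ^ 2 / (2 * c) ∈ Ici t₀ := le_add_of_nonneg_right (a := t₀) (by positivity)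
  have hlt : ‖θ (t₀ + M ^ 2 / (2 * c))‖ ^ 2 < M ^ 2 :=
    pow_lt_pow_left₀ (hM _ ht) (norm_nonneg _) two_ne_zero
  have hge := hgrowth _ ht
  rw [add_sub_cancel_left, mul_div_cancel₀ _ (by positivity)] at hge
  exact hlt.not_ge hge

/-- While `log ‖θ‖` grows by `1` the direction moves little, and over that window a nearly constant
normalized margin forces a time of small radial deviation. -/
lemma exists_radialDeviation_lt (hθ : IsSeparatingFlow q s L θ t₀) (ha : a ∈ Ici t₀) {δ : ℝ}
    (hδ : 0 < δ) (hΓ : ∀ b ≥ a, Real.log (normalizedMargin q s L (θ b)) -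
      Real.log (normalizedMargin q s L (θ a)) < δ ^ 2) :
    ∃ t ≥ a, ‖NormedSpace.normalize (θ t) - NormedSpace.normalize (θ a)‖ < 2 * δ ∧
      radialDeviation (θ t) (descent q s (θ t)) < δ := by
  obtain ⟨c, hc, hac⟩ :=
    (((Real.tendsto_log_atTop.comp hθ.tendsto_norm_atTop).eventually_ge_atTop
      (Real.log ‖θ a‖ + 1)).and (eventually_ge_atTop a)).exists
  obtain ⟨b, ⟨hab, -⟩, hb : Real.log ‖θ b‖ = Real.log ‖θ a‖ + 1⟩ :=
    intermediate_value_Icc (f := fun t => Real.log ‖θ t‖) hac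
      (fun t ht => (hθ.hasDerivWithinAt_log_norm (le_trans ha ht.1)).continuousWithinAt.mono
        fun u hu => le_trans ha hu.1) ⟨(lt_add_one _).le, hc⟩
  obtain ⟨t, ⟨hat, htb⟩, hdev⟩ :
      ∃ t ∈ Icc a b, radialDeviation (θ t) (descent q s (θ t)) ^ 2 < δ ^ 2 := by
    by_contra! hge
    have hgrowth := hθ.mul_log_norm_sub_le ha hab hge
    rw [hb, add_sub_cancel_left, mul_one] at hgrowth
    exact (hΓ b hab).not_ge hgrowth
  refine ⟨t, hat, ?_, lt_of_pow_lt_pow_left₀ 2 hδ.le hdev⟩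
  have hlog : Real.log ‖θ t‖ - Real.log ‖θ a‖ ≤ 1 := by
    linarith [hθ.log_norm_monotoneOn (le_trans ha hat) (le_trans ha hab) htb]
  calc ‖NormedSpace.normalize (θ t) - NormedSpace.normalize (θ a)‖
      ≤ _ := hθ.norm_normalize_sub_le ha hat hδ
    _ < δ * 1 + δ⁻¹ * δ ^ 2 := add_lt_add_of_le_of_lt
        (mul_le_mul_of_nonneg_left hlog hδ.le) (mul_lt_mul_of_pos_left (hΓ t hat) (inv_pos.2 hδ))
    _ = 2 * δ := by field_simp; ring

lemma mapClusterPt_normalize_prod (hθ : IsSeparatingFlow q s L θ t₀) {z : E}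
    (hz : MapClusterPt z atTop fun t => NormedSpace.normalize (θ t)) :
    MapClusterPt (z, (0 : ℝ)) atTop fun t =>
      (NormedSpace.normalize (θ t), radialDeviation (θ t) (descent q s (θ t))) := by
  refine Metric.nhds_basis_ball.mapClusterPt_iff_frequently.2 fun ε hε => ?_
  obtain ⟨T, hT, hΓ⟩ :=
    hθ.exists_log_normalizedMargin_sub_lt (by positivity : 0 < (ε / 4) ^ 2)
  refine frequently_atTop.2 fun T' => ?_
  obtain ⟨a, hTa, haz⟩ :=
    frequently_atTop.1 (hz.frequently (Metric.ball_mem_nhds z (half_pos hε))) (max T T')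
  obtain ⟨t, hat, hdir, hdev⟩ := hθ.exists_radialDeviation_lt
    (le_trans hT (le_of_max_le_left hTa)) (by positivity) (hΓ a (le_of_max_le_left hTa))
  refine ⟨t, (le_of_max_le_right hTa).trans hat, ?_⟩
  rw [Metric.mem_ball, Prod.dist_eq, max_lt_iff]
  constructor
  · rw [← dist_eq_norm] at hdir
    linarith [dist_triangle (NormedSpace.normalize (θ t)) (NormedSpace.normalize (θ a)) z,
      Metric.mem_ball.1 haz]
  · rw [Real.dist_0_eq_abs, radialDeviation, abs_norm]
    exact hdev.trans (by linarith)

end IsSeparatingFlow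

section Multiplier

variable {E ι N : Type*} [NormedAddCommGroup E] [InnerProductSpace ℝ E] [CompleteSpace E]
  [Fintype ι] [Fintype N] [DecidableEq N] [Nonempty ι] {q : ι → E → ℝ} {s : ι → N} {L : ℕ}
  [NeZero L] {x : E}

/-- The softmax weights in the normalization in which they are approximate Lagrange multipliers at
`normalize x`. -/
def multiplier (q : ι → E → ℝ) (s : ι → N) (L : ℕ) (x : E) (p : ι) : ℝ :=
  weight q s p x * (‖x‖ ^ L / ⟪x, descent q s x⟫)

namespace IsHomogeneousModel

lemma multiplier_pos (hq : IsHomogeneousModel q L) (hx : logisticLoss q s x < Real.log 2) (p : ι) :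
    0 < multiplier q s L x p :=
  mul_pos (weight_pos p) (div_pos (pow_pos (norm_pos_iff.2 (hq.ne_zero hx)) L)
    (hq.inner_descent_pos hx))

lemma norm_sum_multiplier_smul_gradient_sub (hq : IsHomogeneousModel q L)
    (hx : logisticLoss q s x < Real.log 2) :
    ‖∑ p, multiplier q s L x p • ∇ (q p) (NormedSpace.normalize x) - NormedSpace.normalize x‖ =
      radialDeviation x (descent q s x) := by
  suffices hsum : ∑ p, multiplier q s L x p • ∇ (q p) (NormedSpace.normalize x) =
      (‖x‖ / ⟪x, descent q s x⟫) • ∑ p, weight q s p x • ∇ (q p) x by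
    rw [hsum, ← descent_eq_sum fun p => hq.differentiable p x, radialDeviation]
  rw [Finset.smul_sum]
  refine Finset.sum_congr rfl fun p _ => ?_
  rw [multiplier, mul_div_left_comm, mul_comm, ← smul_smul,
    (hq.posHomogeneous p).norm_pow_smul_gradient_normalize (hq.ne_zero hx), smul_smul, smul_smul]
  congr 1
  ring

lemma sum_multiplier_mul (hq : IsHomogeneousModel q L) (hx : logisticLoss q s x < Real.log 2) :
    L * ∑ p, multiplier q s L x p * q p (NormedSpace.normalize x) = 1 := by
  have hsum : ∑ p, multiplier q s L x p * q p (NormedSpace.normalize x) =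
      (∑ p, weight q s p x * q p x) / ⟪x, descent q s x⟫ := by
    rw [Finset.sum_div]
    refine Finset.sum_congr rfl fun p _ => ?_
    rw [← (hq.posHomogeneous p).norm_pow_smul_normalize (hq.ne_zero hx), multiplier, smul_eq_mul]
    ring
  rw [hsum, ← mul_div_assoc, ← hq.inner_descent_eq, div_self (hq.inner_descent_pos hx).ne']

lemma multiplier_le_inv (hq : IsHomogeneousModel q L) (hx : logisticLoss q s x < Real.log 2)
    {γ : ℝ} (hγ : 0 < γ) (hle : ∀ p, γ ≤ q p (NormedSpace.normalize x)) (p : ι) :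
    multiplier q s L x p ≤ γ⁻¹ := by
  have hterm : ∀ p, 0 ≤ multiplier q s L x p * q p (NormedSpace.normalize x) := fun p =>
    mul_nonneg (hq.multiplier_pos hx p).le (hγ.le.trans (hle p))
  rw [← one_div, le_div_iff₀ hγ]
  calc multiplier q s L x p * γ ≤ multiplier q s L x p * q p (NormedSpace.normalize x) :=
        mul_le_mul_of_nonneg_left (hle p) (hq.multiplier_pos hx p).le
    _ ≤ ∑ p, multiplier q s L x p * q p (NormedSpace.normalize x) :=
        Finset.single_le_sum (fun p _ => hterm p) (Finset.mem_univ p)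
    _ ≤ L * ∑ p, multiplier q s L x p * q p (NormedSpace.normalize x) :=
        le_mul_of_one_le_left (Finset.sum_nonneg fun p _ => hterm p)
          (Nat.one_le_cast.2 NeZero.one_le)
    _ = 1 := hq.sum_multiplier_mul hx

lemma multiplier_le_mul_exp (hq : IsHomogeneousModel q L) (hx : logisticLoss q s x < Real.log 2)
    (p p' : ι) :
    multiplier q s L x p ≤ 2 * multiplier q s L x p' * Real.exp (-(‖x‖ ^ L *
      (q p (NormedSpace.normalize x) - q p' (NormedSpace.normalize x)))) := by
  have hscale : 0 ≤ ‖x‖ ^ L / ⟪x, descent q s x⟫ :=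
    div_nonneg (pow_nonneg (norm_nonneg x) L) (hq.inner_descent_pos hx).le
  have hweight : weight q s p x ≤ 2 * weight q s p' x * Real.exp (-(q p x - q p' x)) :=
    calc weight q s p x ≤ Real.exp (-q p x) := weight_le_exp_neg p
      _ = Real.exp (-q p' x) * Real.exp (-(q p x - q p' x)) := by
          rw [← Real.exp_add]
          ring_nf
      _ ≤ _ := mul_le_mul_of_nonneg_right (exp_neg_le_two_mul_weight hx p') (Real.exp_pos _).le
  have hmargin : ∀ p, ‖x‖ ^ L * q p (NormedSpace.normalize x) = q p x := fun p =>
    (hq.posHomogeneous p).norm_pow_smul_normalize (hq.ne_zero hx)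
  rw [mul_sub, hmargin, hmargin]
  calc multiplier q s L x p ≤ _ := mul_le_mul_of_nonneg_right hweight hscale
    _ = 2 * multiplier q s L x p' * Real.exp (-(q p x - q p' x)) := by
        rw [multiplier]
        ring

end IsHomogeneousModel

end Multiplier

section Limit

variable {α E ι N : Type*} [NormedAddCommGroup E] [InnerProductSpace ℝ E] [CompleteSpace E]
  [Fintype ι] [Fintype N] [DecidableEq N] [Nonempty ι] {q : ι → E → ℝ} {s : ι → N} {L : ℕ}
  [NeZero L] {l : Filter α} [l.NeBot] {x : α → E} {z : E} {μ : ι → ℝ}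

namespace IsHomogeneousModel

lemma sum_smul_gradient_eq_of_tendsto (hq : IsHomogeneousModel q L)
    (hx : ∀ᶠ a in l, logisticLoss q s (x a) < Real.log 2)
    (hz : Tendsto (fun a => NormedSpace.normalize (x a)) l (𝓝 z))
    (hμ : Tendsto (fun a => multiplier q s L (x a)) l (𝓝 μ))
    (hdev : Tendsto (fun a => radialDeviation (x a) (descent q s (x a))) l (𝓝 0)) :
    ∑ p, μ p • ∇ (q p) z = z := by
  have hsum : Tendsto (fun a => ‖∑ p, multiplier q s L (x a) p •
      ∇ (q p) (NormedSpace.normalize (x a)) - NormedSpace.normalize (x a)‖) l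
      (𝓝 ‖∑ p, μ p • ∇ (q p) z - z‖) :=
    ((tendsto_finsetSum _ fun p _ => (tendsto_pi_nhds.1 hμ p).smul
      (((hq.continuous_gradient p).tendsto z).comp hz)).sub hz).norm
  refine sub_eq_zero.1 (norm_eq_zero.1 (tendsto_nhds_unique (hsum.congr' ?_) hdev))
  filter_upwards [hx] with a ha using hq.norm_sum_multiplier_smul_gradient_sub ha

lemma eq_zero_of_tendsto_multiplier (hq : IsHomogeneousModel q L)
    (hx : ∀ᶠ a in l, logisticLoss q s (x a) < Real.log 2)
    (hz : Tendsto (fun a => NormedSpace.normalize (x a)) l (𝓝 z))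
    (hμ : Tendsto (fun a => multiplier q s L (x a)) l (𝓝 μ))
    (hnorm : Tendsto (fun a => ‖x a‖) l atTop) {p p' : ι} (hlt : q p' z < q p z) : μ p = 0 := by
  rw [tendsto_pi_nhds] at hμ
  have hmargin : ∀ p, Tendsto (fun a => q p (NormedSpace.normalize (x a))) l (𝓝 (q p z)) :=
    fun p => ((hq.contDiff p).continuous.tendsto z).comp hz
  have hbound : Tendsto (fun a => 2 * multiplier q s L (x a) p' * Real.exp (-(‖x a‖ ^ L *
      (q p (NormedSpace.normalize (x a)) - q p' (NormedSpace.normalize (x a)))))) l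
      (𝓝 (2 * μ p' * 0)) :=
    ((hμ p').const_mul 2).mul (Real.tendsto_exp_neg_atTop_nhds_zero.comp
      (((tendsto_pow_atTop (NeZero.ne L)).comp hnorm).atTop_mul_pos (sub_pos.2 hlt)
        ((hmargin p).sub (hmargin p'))))
  rw [mul_zero] at hbound
  refine le_antisymm (le_of_tendsto_of_tendsto (hμ p) hbound ?_) (ge_of_tendsto (hμ p) ?_)
  · filter_upwards [hx] with a ha using hq.multiplier_le_mul_exp ha p p'
  · filter_upwards [hx] with a ha using (hq.multiplier_pos ha p).le

end IsHomogeneousModel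

end Limit

section KKT

variable {E ι : Type*} [NormedAddCommGroup E] [InnerProductSpace ℝ E] [CompleteSpace E]
  [Fintype ι] {q : ι → E → ℝ} {L : ℕ} {z : E} {c : ℝ} {μ : ι → ℝ}

lemma gradient_half_mul_norm_sq (x : E) : ∇ (fun y : E => 1 / 2 * ‖y‖ ^ 2) x = x := by
  refine HasGradientAt.gradient (hasGradientAt_iff_hasFDerivAt.2 ?_)
  refine ((hasStrictFDerivAt_norm_sq x).hasFDerivAt.const_mul (1 / 2)).congr_fderiv ?_
  ext y
  simp

lemma gradient_one_sub (f : E → ℝ) (x : E) : ∇ (fun y => 1 - f y) x = -∇ f x := by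
  rw [gradient, gradient, fderiv_const_sub, map_neg]

/-- If `c = r ^ L` is the smallest margin of `z`, then `r⁻¹ • z` has smallest margin `1`. -/
lemma IsHomogeneousModel.exists_isKKTPoint_of_multipliers [NeZero L] (hq : IsHomogeneousModel q L)
    (hc : 0 < c) (hle : ∀ p, c ≤ q p z) (hμ : ∀ p, 0 ≤ μ p) (hsum : ∑ p, μ p • ∇ (q p) z = z)
    (hslack : ∀ p, μ p * (q p z - c) = 0) :
    ∃ (r : ℝ) (x : E), 0 < r ∧
      ULPM.IsKKTPoint (fun y => 1 / 2 * ‖y‖ ^ 2) (fun p y => 1 - q p y) x ∧ z = r • x := by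
  obtain ⟨r, hr, rfl⟩ : ∃ r > 0, r ^ L = c :=
    ⟨c ^ (L : ℝ)⁻¹, Real.rpow_pos_of_pos hc _, Real.rpow_inv_natCast_pow hc.le (NeZero.ne L)⟩
  obtain ⟨x, rfl⟩ : ∃ x, r • x = z := ⟨r⁻¹ • z, smul_inv_smul₀ hr.ne' z⟩
  have hmargin : ∀ p, q p (r • x) = r ^ L * q p x := fun p => hq.posHomogeneous p hr x
  simp only [hmargin] at hle hslack
  have hstationary : ∑ p, (μ p * r ^ L / r ^ 2) • ∇ (q p) x = x :=
    calc ∑ p, (μ p * r ^ L / r ^ 2) • ∇ (q p) x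
        = ∑ p, (r / r ^ 2) • μ p • ∇ (q p) (r • x) := Finset.sum_congr rfl fun p _ => by
          rw [div_eq_inv_mul, ← smul_smul, ← smul_smul, div_eq_inv_mul, ← smul_smul,
            smul_comm r, (hq.posHomogeneous p).smul_gradient hr]
      _ = x := by
          rw [← Finset.smul_sum, hsum, smul_smul, div_mul_eq_mul_div, ← sq,
            div_self (pow_ne_zero 2 hr.ne'), one_smul]
  refine ⟨r, x, hr, ⟨fun p => sub_nonpos.2 ((le_mul_iff_one_le_right hc).1 (hle p)),
    fun p => μ p * r ^ L / r ^ 2, fun p => by have := hμ p; positivity, ?_, fun p => ?_⟩, rfl⟩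
  · simp only [gradient_half_mul_norm_sq, gradient_one_sub, smul_neg, Finset.sum_neg_distrib,
      hstationary, add_neg_cancel]
  · rw [← neg_eq_zero, ← zero_div (r ^ 2), ← hslack p]
    ring

end KKT

end HomogeneousLogistic

namespace ULPM

open HomogeneousLogistic

variable {K n d : ℕ}

/-- The margin `w_k ⬝ h_{k,i} - w_j ⬝ h_{k,i}` of the `i`-th sample of class `k` over the label `j`,
for `p = (k, j, i)`. -/
def margin (p : SepIndex K n) (θ : Params K n d) : ℝ :=
  logit θ p.1.1 p.1.1 p.1.2.2 - logit θ p.1.2.1 p.1.1 p.1.2.2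

/-- The sample `(k, i)` to which the separation constraint `(k, j, i)` belongs. -/
def sample (p : SepIndex K n) : Fin K × Fin n := (p.1.1, p.1.2.2)

lemma logit_eq_sum (θ : Params K n d) (j k : Fin K) (i : Fin n) :
    logit θ j k i = ∑ a, θ (Sum.inl (j, a)) * θ (Sum.inr (a, (k, i))) := rfl

lemma contDiff_logit (j k : Fin K) (i : Fin n) :
    ContDiff ℝ 1 fun θ : Params K n d => logit θ j k i := by
  simp only [logit_eq_sum]
  fun_prop

lemma logit_smul (c : ℝ) (θ : Params K n d) (j k : Fin K) (i : Fin n) :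
    logit (c • θ) j k i = c ^ 2 * logit θ j k i := by
  simp only [logit_eq_sum, PiLp.smul_apply, smul_eq_mul, Finset.mul_sum]
  exact Finset.sum_congr rfl fun a _ => by ring

lemma isHomogeneousModel_margin : IsHomogeneousModel (margin (K := K) (n := n) (d := d)) 2 where
  contDiff _ := (contDiff_logit _ _ _).sub (contDiff_logit _ _ _)
  posHomogeneous _ _ _ _ := by
    simp only [margin, logit_smul, smul_eq_mul, mul_sub]

lemma one_add_expSum_margin (k : Fin K) (i : Fin n) (θ : Params K n d) :
    1 + expSum margin sample (k, i) θ = ∑ j, Real.exp (logit θ j k i - logit θ k k i) := by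
  rw [← Finset.add_sum_erase _ _ (Finset.mem_univ k), sub_self, Real.exp_zero, expSum]
  congr 1
  refine Finset.sum_bij (fun p _ => p.1.2.1) ?_ ?_ ?_ ?_
  · rintro ⟨⟨k', j, i'⟩, hne⟩ hp
    obtain ⟨rfl, rfl⟩ : k' = k ∧ i' = i := by simpa [sample] using hp
    simpa using hne.symm
  · rintro ⟨⟨k₁, j₁, i₁⟩, h₁⟩ hp₁ ⟨⟨k₂, j₂, i₂⟩, h₂⟩ hp₂ h
    simp only [sample, Finset.mem_filter, Finset.mem_univ, true_and, Prod.mk.injEq] at hp₁ hp₂ h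
    simp [hp₁, hp₂, h]
  · intro j hj
    exact ⟨⟨(k, j, i), (Finset.ne_of_mem_erase hj).symm⟩, by simp [sample], rfl⟩
  · rintro ⟨⟨k', j, i'⟩, hne⟩ hp
    obtain ⟨rfl, rfl⟩ : k' = k ∧ i' = i := by simpa [sample] using hp
    rw [margin, neg_sub]

lemma loss_eq_logisticLoss : loss (K := K) (n := n) (d := d) = logisticLoss margin sample := by
  funext θ
  rw [loss, logisticLoss, Fintype.sum_prod_type, ← Finset.sum_neg_distrib]
  refine Finset.sum_congr rfl fun k _ => ?_
  rw [← Finset.sum_neg_distrib]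
  refine Finset.sum_congr rfl fun i _ => ?_
  rw [one_add_expSum_margin, ← Real.log_inv, inv_div, Finset.sum_div]
  simp only [Real.exp_sub]

lemma frobSq_add_frobSq (θ : Params K n d) : frobSq (W θ) + frobSq (H θ) = ‖θ‖ ^ 2 := by
  rw [EuclideanSpace.norm_sq_eq, Fintype.sum_sum_type]
  simp only [frobSq, W, H, Matrix.of_apply, Fintype.sum_prod_type, Real.norm_eq_abs, sq_abs]

lemma normalized_eq_normalize (θ : Params K n d) : normalized θ = NormedSpace.normalize θ := by
  rw [normalized, frobSq_add_frobSq, Real.sqrt_sq (norm_nonneg _), NormedSpace.normalize]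

lemma isSepKKTPoint_iff {θ : Params K n d} :
    IsSepKKTPoint θ ↔ IsKKTPoint (fun x => 1 / 2 * ‖x‖ ^ 2) (fun p x => 1 - margin p x) θ := by
  have hobj : sepObjective (K := K) (n := n) (d := d) = fun x => 1 / 2 * ‖x‖ ^ 2 :=
    funext fun x => by rw [sepObjective, ← mul_add, frobSq_add_frobSq]
  rw [IsSepKKTPoint, hobj]
  rfl

lemma nonempty_sepIndex (hK : 2 ≤ K) (hn : 1 ≤ n) : Nonempty (SepIndex K n) :=
  ⟨⟨(⟨0, by omega⟩, ⟨1, by omega⟩, ⟨0, by omega⟩), by simp⟩⟩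

lemma IsGradientFlow.isSeparatingFlow {θ : ℝ → Params K n d} (hθ : IsGradientFlow θ) {t₀ : ℝ}
    (ht₀ : 0 ≤ t₀) (hloss : loss (θ t₀) < Real.log 2) :
    IsSeparatingFlow margin sample 2 θ t₀ where
  toIsHomogeneousModel := isHomogeneousModel_margin
  hasDerivWithinAt t ht := by
    rw [descent, ← loss_eq_logisticLoss]
    exact (hθ t (le_trans ht₀ ht)).mono (Ici_subset_Ici.2 ht₀)
  logisticLoss_lt := by rwa [← loss_eq_logisticLoss]

end ULPM

end

open HomogeneousLogistic in
theorem mainTheorem2_general {E ι N : Type*} [NormedAddCommGroup E]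
    [InnerProductSpace ℝ E] [CompleteSpace E] [Fintype ι] [Fintype N] [DecidableEq N] [Nonempty ι]
    {q : ι → E → ℝ} {s : ι → N} {L : ℕ} [NeZero L] {θ : ℝ → E} {t₀ : ℝ}
    (hθ : IsSeparatingFlow q s L θ t₀) {z : E}
    (hz : MapClusterPt z atTop fun t => NormedSpace.normalize (θ t)) :
    ∃ (r : ℝ) (x : E), 0 < r ∧
      ULPM.IsKKTPoint (fun y => 1 / 2 * ‖y‖ ^ 2) (fun p y => 1 - q p y) x ∧ z = r • x := by
  obtain ⟨U, hU, hlim⟩ := mapClusterPt_iff_ultrafilter.1 (hθ.mapClusterPt_normalize_prod hz)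
  have hdir : Tendsto (fun t => NormedSpace.normalize (θ t)) U (𝓝 z) := hlim.fst_nhds
  have hlate : ∀ᶠ t in U, t ∈ Ici t₀ := hU (eventually_ge_atTop t₀)
  have hloss : ∀ᶠ t in U, logisticLoss q s (θ t) < Real.log 2 :=
    hlate.mono fun t ht => hθ.logisticLoss_lt_log_two ht
  set γ := normalizedMargin q s L (θ t₀)
  have hγ : 0 < γ := hθ.normalizedMargin_pos hθ.logisticLoss_lt
  have hmargin : ∀ᶠ t in U, ∀ p, γ ≤ q p (NormedSpace.normalize (θ t)) :=
    hlate.mono fun t ht p => (hθ.normalizedMargin_monotoneOn self_mem_Ici ht ht).trans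
      (hθ.normalizedMargin_le (hθ.flow_ne_zero ht) p)
  have hmem : ∀ᶠ t in U, multiplier q s L (θ t) ∈ Icc (0 : ι → ℝ) fun _ => γ⁻¹ := by
    filter_upwards [hloss, hmargin] with t ht htγ using
      ⟨fun p => (hθ.multiplier_pos ht p).le, hθ.multiplier_le_inv ht hγ htγ⟩
  obtain ⟨μ, hμ, hμlim⟩ := isCompact_Icc.ultrafilter_le_nhds
    (U.map fun t => multiplier q s L (θ t)) (le_principal_iff.2 hmem)
  obtain ⟨p₀, hp₀⟩ := Finite.exists_min fun p => q p z
  refine hθ.exists_isKKTPoint_of_multipliers (hγ.trans_le ?_) hp₀ hμ.1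
    (hθ.sum_smul_gradient_eq_of_tendsto hloss hdir hμlim hlim.snd_nhds) fun p => ?_
  · exact ge_of_tendsto (((hθ.contDiff p₀).continuous.tendsto z).comp hdir)
      (hmargin.mono fun t ht => ht p₀)
  · rcases (hp₀ p).eq_or_lt with heq | hlt
    · rw [heq, sub_self, mul_zero]
    · rw [hθ.eq_zero_of_tendsto_multiplier hloss hdir hμlim
        (hθ.tendsto_norm_atTop.mono_left hU) hlt, zero_mul]

theorem mainTheorem2 (K n d : ℕ) (hK : 2 ≤ K) (hn : 1 ≤ n)
    (θ : ℝ → ULPM.Params K n d) (hθ : ULPM.IsGradientFlow θ)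
    (t₀ : ℝ) (ht₀ : 0 ≤ t₀) (hloss : ULPM.loss (θ t₀) < Real.log 2)
    (p : ULPM.Params K n d)
    (hp : MapClusterPt p atTop (fun t : ℝ => ULPM.normalized (θ t))) :
    ∃ (c : ℝ) (x : ULPM.Params K n d), 0 < c ∧ ULPM.IsSepKKTPoint x ∧ p = c • x := by
  have := ULPM.nonempty_sepIndex hK hn
  simp only [ULPM.normalized_eq_normalize, ULPM.isSepKKTPoint_iff] at hp ⊢
  exact mainTheorem2_general (hθ.isSeparatingFlow ht₀ hloss) hp
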